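/- Setting. Let $\mathcal C$ be a triangulated category linear over a field $\Bbbk$ (for instance the homotopy category of an ind-constructible triangulated $A_\infty$-category), write $\mathrm{Ext}^k(A,B)=\mathrm{Hom}(A,B[k])$, and let $\mathbb V$ be a small groupoid. Subcategories are full and closed under isomorphism. A *$\mathbb V$-collection* $\Phi$ in $\mathcal C$ consists of subcategories $\mathcal C_{ij}$ ($i,j\in\mathbb V$), maps $\epsilon_{ij}:\mathrm{Ob}(\mathcal C_{ij})\to\mathrm{Hom}_{\mathbb V}(i,j)$, and correspondences $W_{ijk}$, that is, isomorphism-invariant families of (possibly empty) affine subspaces $W_{ijk}(A,B)$ of $\mathrm{Ext}^*(A,B)$, each lying in a single degree, such that (a) all degrees of the $W_{ijk}$ are odd; for $A\in\mathcal C_{jk}$, $B\in\mathcal C_{ij}$ the fibre $W_{ijk}(A,B)$ is non-empty, and the cone of $A[-r]\to B$ lies in $\mathcal C_{ik}$ for each of its elements (in degree $r$); (b) $\mathcal C_{ij}=\mathcal C_{ji}[1]$; (c) for $E\in\mathcal C_{ij}$, $\mathrm{id}_{E[1]}\in\mathrm{Ext}^1(E[1],E)$ belongs to $W_{iji}$;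 (d) the $\epsilon_{ij}$ induce an isomorphism onto $\mathbb V$ from the category with the objects of $\mathbb V$, morphism sets $\{[E]:E\in\mathcal C_{ij}\}\subset K_0(\mathcal C)$, and addition as composition. A *pre-slicing* $\mathcal P$ is a family of subcategories $\mathcal P_{ij}(\theta)\subset\mathcal C_{ij}$ ($\theta\in\mathbb R$) with $\mathcal P_{ij}(\theta+1)=\mathcal P_{ji}(\theta)[1]$ and $\mathrm{Hom}(E_1,E_2)=0$ whenever $E_1\in\mathcal P_{ij}(\theta_1)$, $E_2\in\mathcal P_{kl}(\theta_2)$, $\theta_1>\theta_2$. A *Harder–Narasimhan (HN) sequence* of $E\in\mathcal C_{ij}$ along a path $i=i_0,\dots,i_n=j$ of objects of $\mathbb V$ consists of phases $\theta_1>\dots>\theta_n$, non-zero objects $A_k\in\mathcal P_{i_{k-1}i_k}(\theta_k)$ such that $\epsilon_{ij}(E)$ is the composition of the morphisms $\epsilon_{i_{k-1}i_k}(A_k)$, and exact triangles $E_{k-1}\to E_k\to A_k\xrightarrow{\delta_k}E_{k-1}[1]$ with $E_0=0$, $E_n\cong E$ and $\delta_k\in \mathrm{Ext}^1(A_k,E_{k-1})\cap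 W_{i_0i_{k-1}i_k}$. A *$\mathbb V$-stability condition* $(Z,\mathcal P)$ on $\Phi$ is a groupoid homomorphism $Z:\mathbb V\to\mathbb C$ and a pre-slicing $\mathcal P$ such that $\arg Z(\epsilon_{ij}(E))\equiv\pi\theta \pmod{2\pi}$ (in particular $Z(\epsilon_{ij}(E))\ne0$) for every non-zero $E\in\mathcal P_{ij}(\theta)$; every non-zero $E\in\mathcal C_{ij}$ has an HN sequence; and the support property holds: for a norm on $\Gamma_{\mathbb V}\otimes\mathbb R$, where $\Gamma_{\mathbb V}$ is the universal abelian group receiving a homomorphism from $\mathbb V$, there is $K>0$ with $\|\gamma\|\le K|Z(\gamma)|$ for the class $\gamma$ of $\epsilon_{ij}(E)$, for every non-zero $E\in\mathcal P_{ij}(\theta)$. Statement. Let $(Z,\mathcal P)$ be a $\mathbb V$-stability condition on a $\mathbb V$-collection $\Phi$ and let $E\in\mathcal C_{ij}$. 1. For each path $i=i_0,\dots,i_n=j$ of objects of $\mathbb V$ there is, up to unique isomorphism, at most one HN sequence of $E$ along this path: any two have the same phases, and there is exactly one family of isomorphisms between their objects $E_k$ and between their factors $A_k$ that commutes with all maps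 of the triangles and with the identifications $E_n\cong E$. 2. If $A_1,\dots,A_n$ and $B_1,\dots,B_m$ are the factors of HN sequences of $E$ along two possibly different paths from $i$ to $j$, then $m=n$, and for every $k$ the phases of $A_k$ and $B_k$ are equal and $A_k\cong B_k$. -/

import Mathlib

open CategoryTheory CategoryTheory.Limits CategoryTheory.Pretriangulated
open scoped TensorProduct

noncomputable section

universe v u w' w

namespace VStab

section Triangulated

variable (C : Type u) [Category.{v} C] [HasZeroObject C] [HasShift C ℤ] [Preadditive C]
  [∀ n : ℤ, (shiftFunctor C n).Additive] [Pretriangulated C]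

/-- The relations `[Y] - [X] - [Z]` for the distinguished triangles `X ⟶ Y ⟶ Z ⟶ X⟦1⟧`. -/
def K0Relations : Set (FreeAbelianGroup C) :=
  {r | ∃ T : Triangle C, T ∈ distTriang C ∧
    r = FreeAbelianGroup.of T.obj₂ - FreeAbelianGroup.of T.obj₁ - FreeAbelianGroup.of T.obj₃}

/-- The Grothendieck group `K₀` of a triangulated category. -/
abbrev K0 : Type u := FreeAbelianGroup C ⧸ AddSubgroup.closure (K0Relations C)

variable {C}

/-- The class `[X]` in `K₀`. -/
def K0.cls (X : C) : K0 C := QuotientAddGroup.mk (FreeAbelianGroup.of X)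

/-- `X` is a cone of the class `δ ∈ Ext^k(A, B) = Hom(A, B⟦k⟧)`, that is, of the corresponding
morphism `A⟦-k⟧ ⟶ B`. The defining triangle is written after shifting it by `k`:
`A ⟶ B⟦k⟧ ⟶ X⟦k⟧ ⟶ A⟦1⟧`. -/
def IsConeOf {A B : C} {k : ℤ} (δ : A ⟶ B⟦k⟧) (X : C) : Prop :=
  ∃ (g : B⟦k⟧ ⟶ X⟦k⟧) (h : X⟦k⟧ ⟶ A⟦(1 : ℤ)⟧), Triangle.mk δ g h ∈ distTriang C

end Triangulated

section Enhancement

variable (𝕜 : Type w) [Field 𝕜]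
  (C : Type u) [Category.{v} C] [HasZeroObject C] [HasShift C ℤ] [Preadditive C]
  [∀ n : ℤ, (shiftFunctor C n).Additive] [Pretriangulated C] [Linear 𝕜 C]

/-- A correspondence: a homogeneous affine subbundle, with possibly empty fibres, of the bundle
`Ext^*` over pairs of objects. `fiber A B k` is the set of the elements of degree `k` over
`(A, B)`; homogeneity says that a fibre lives in a single degree, except that the fibre `{0}` may
be viewed in several degrees. -/
structure Correspondence where
  fiber (A B : C) (k : ℤ) : AffineSubspace 𝕜 (A ⟶ B⟦k⟧)
  homogeneous {A B : C} {k l : ℤ} (hkl : k ≠ l) {δ : A ⟶ B⟦k⟧} (hδ : δ ∈ fiber A B k)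
    (hl : (fiber A B l : Set (A ⟶ B⟦l⟧)).Nonempty) : δ = 0
  /-- A bundle over the stack of pairs of objects is invariant under isomorphisms. -/
  iso_mem {A A' B B' : C} {k : ℤ} (e : A ≅ A') (f : B ≅ B') {δ : A ⟶ B⟦k⟧}
    (hδ : δ ∈ fiber A B k) : e.inv ≫ δ ≫ f.hom⟦k⟧' ∈ fiber A' B' k

/-- An enhancement of a category `D` by a triangulated category `C`. -/
structure Enhancement (D : Type*) [Category* D] where
  /-- The full (replete) subcategories `C_ij`. -/
  sub (i j : D) : ObjectProperty C
  sub_iso (i j : D) : (sub i j).IsClosedUnderIsomorphisms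
  /-- The maps `ε_ij` from the objects of `C_ij` to `Hom(i, j)`. -/
  ε {i j : D} (E : C) (hE : sub i j E) : i ⟶ j
  /-- The correspondences `W_ijk`. -/
  W (i j k : D) : Correspondence 𝕜 C
  /-- `C_jk × C_ij` is contained in the support of `W_ijk`. -/
  supp {i j k : D} {A B : C} (hA : sub j k A) (hB : sub i j B) :
    ∃ r : ℤ, (((W i j k).fiber A B r : Set (A ⟶ B⟦r⟧))).Nonempty
  /-- The product of objects of `C_jk` and `C_ij`, given by the cones, lies over `C_ik`. -/
  cone {i j k : D} {A B X : C} (hA : sub j k A) (hB : sub i j B) {r : ℤ} {δ : A ⟶ B⟦r⟧}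
    (hδ : δ ∈ (W i j k).fiber A B r) (hX : IsConeOf δ X) : sub i k X

variable {𝕜 C} in
/-- The enhancement is odd: all degrees of its correspondences are odd. -/
def Enhancement.IsOdd {D : Type*} [Category* D] (Φ : Enhancement 𝕜 C D) : Prop :=
  ∀ (i j k : D) (A B : C) (r : ℤ),
    ((Φ.W i j k).fiber A B r : Set (A ⟶ B⟦r⟧)).Nonempty → Odd r

/-- A `V`-collection of subcategories of `C`. The last four fields say that the maps `ε_ij` induce
an isomorphism onto `V` from the category with the same objects, with
`Hom(i, j) = {[E] : E ∈ C_ij} ⊆ K₀(C)`, and with addition in `K₀(C)` as composition. -/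
structure Collection (V : Type*) [Groupoid V] extends Enhancement 𝕜 C V where
  odd : toEnhancement.IsOdd
  /-- `C_ij = C_ji[1]`. -/
  sub_shift (i j : V) (E : C) : sub i j (E⟦(1 : ℤ)⟧) ↔ sub j i E
  /-- The identity of `E[1]`, as an element of `Ext¹(E[1], E)`, belongs to `W_iji`. -/
  id_mem {i j : V} {E : C} (hE : sub i j E) :
    (𝟙 (E⟦(1 : ℤ)⟧) : E⟦(1 : ℤ)⟧ ⟶ E⟦(1 : ℤ)⟧) ∈ (W i j i).fiber (E⟦(1 : ℤ)⟧) E 1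
  ε_congr {i j : V} {E F : C} (hE : sub i j E) (hF : sub i j F) (h : K0.cls E = K0.cls F) :
    ε E hE = ε F hF
  ε_inj {i j : V} {E F : C} (hE : sub i j E) (hF : sub i j F) (h : ε E hE = ε F hF) :
    K0.cls E = K0.cls F
  ε_surj {i j : V} (γ : i ⟶ j) : ∃ (E : C) (hE : sub i j E), ε E hE = γ
  ε_comp {i j k : V} {A B X : C} (hA : sub i j A) (hB : sub j k B) (hX : sub i k X)
    (h : K0.cls X = K0.cls A + K0.cls B) : ε X hX = ε A hA ≫ ε B hB

end Enhancement

section Charge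

variable (V : Type*) [Groupoid V]

/-- A central charge: a homomorphism of groupoids from `V` to the groupoid with one object whose
morphisms are the complex numbers under addition. -/
abbrev CentralCharge := V ⥤ SingleObj (Multiplicative ℂ)

variable {V} in
/-- The complex number `Z(γ)`. -/
def CentralCharge.val (Z : CentralCharge V) {i j : V} (γ : i ⟶ j) : ℂ :=
  Multiplicative.toAdd (show Multiplicative ℂ from Z.map γ)

/-- The relations `[f ≫ g] - [f] - [g]` between the morphisms of `V`. -/
def GammaRelations : Set (FreeAbelianGroup (Σ p : V × V, p.1 ⟶ p.2)) :=
  {r | ∃ (i j k : V) (f : i ⟶ j) (g : j ⟶ k),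
    r = FreeAbelianGroup.of ⟨(i, k), f ≫ g⟩ - FreeAbelianGroup.of ⟨(i, j), f⟩
      - FreeAbelianGroup.of ⟨(j, k), g⟩}

/-- The grading group `Γ_V`, the abelian group through which every homomorphism from the groupoid
`V` to an abelian group factors uniquely. A connected component with vertex group `Γ` (abelian)
and set of vertices `S` contributes the summand `Γ ⊕ {a ∈ ℤ^S : ∑ a = 0}`. -/
abbrev Gamma := FreeAbelianGroup (Σ p : V × V, p.1 ⟶ p.2) ⧸ AddSubgroup.closure (GammaRelations V)

variable {V} in
/-- The element of `Γ_V` given by a morphism of `V`. -/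
def Gamma.cls {i j : V} (γ : i ⟶ j) : Gamma V :=
  QuotientAddGroup.mk (FreeAbelianGroup.of ⟨(i, j), γ⟩)

end Charge

section Stability

variable {𝕜 : Type w} [Field 𝕜]
  {C : Type u} [Category.{v} C] [HasZeroObject C] [HasShift C ℤ] [Preadditive C]
  [∀ n : ℤ, (shiftFunctor C n).Additive] [Pretriangulated C] [Linear 𝕜 C]
  {V : Type*} [Groupoid V]

/-- A pre-slicing of a `V`-collection, by full (replete) subcategories `P_ij(θ) ⊆ C_ij`. -/
structure PreSlicing (Φ : Collection 𝕜 C V) where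
  ss (i j : V) (θ : ℝ) : ObjectProperty C
  ss_iso (i j : V) (θ : ℝ) : (ss i j θ).IsClosedUnderIsomorphisms
  ss_le (i j : V) (θ : ℝ) : ss i j θ ≤ Φ.sub i j
  /-- `P_ij(θ + 1) = P_ji(θ)[1]`. -/
  ss_shift (i j : V) (θ : ℝ) (E : C) : ss i j (θ + 1) (E⟦(1 : ℤ)⟧) ↔ ss j i θ E
  hom_eq_zero {i j k l : V} {θ₁ θ₂ : ℝ} (hθ : θ₂ < θ₁) {E₁ E₂ : C} (h₁ : ss i j θ₁ E₁)
    (h₂ : ss k l θ₂ E₂) (f : E₁ ⟶ E₂) : f = 0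

/-- A sequence `i = i_0, …, i_n = j` of objects of `V`. -/
structure ObjPath (i j : V) where
  length : ℕ
  vertex : Fin (length + 1) → V
  vertex_zero : vertex 0 = i
  vertex_last : vertex (Fin.last length) = j

/-- The composition `i_0 ⟶ i_k` of the first `k` morphisms of a composable sequence. -/
def composite {n : ℕ} {x : Fin (n + 1) → V} (γ : ∀ k : Fin n, x k.castSucc ⟶ x k.succ)
    (k : Fin (n + 1)) : x 0 ⟶ x k :=
  Fin.induction (motive := fun k => x 0 ⟶ x k) (𝟙 (x 0)) (fun k c => c ≫ γ k) k

/-- A Harder–Narasimhan sequence along the path `p` of an object `E` of `C_ij`. The object `A k`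
is the factor that the mathematics numbers `k + 1`. -/
structure HNSequence {Φ : Collection 𝕜 C V} (P : PreSlicing Φ) {i j : V} (p : ObjPath i j)
    (E : C) (hE : Φ.sub i j E) where
  /-- The phases `θ_1 > … > θ_n`. -/
  phase : Fin p.length → ℝ
  phase_anti : StrictAnti phase
  /-- The nonzero semistable factors. -/
  A : Fin p.length → C
  A_mem (k : Fin p.length) : P.ss (p.vertex k.castSucc) (p.vertex k.succ) (phase k) (A k)
  A_ne (k : Fin p.length) : ¬ IsZero (A k)
  /-- `ε(E)` is the composition of the `ε(A_k)`. -/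
  ε_eq : composite (fun k => Φ.ε (A k) (P.ss_le _ _ _ _ (A_mem k))) (Fin.last p.length) =
    eqToHom p.vertex_zero ≫ Φ.ε E hE ≫ eqToHom p.vertex_last.symm
  /-- The objects `E_0, …, E_n` of the convolution. -/
  obj : Fin (p.length + 1) → C
  obj_zero : IsZero (obj 0)
  objLast : obj (Fin.last p.length) ≅ E
  ι (k : Fin p.length) : obj k.castSucc ⟶ obj k.succ
  π (k : Fin p.length) : obj k.succ ⟶ A k
  δ (k : Fin p.length) : A k ⟶ (obj k.castSucc)⟦(1 : ℤ)⟧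
  δ_mem (k : Fin p.length) : δ k ∈
    (Φ.W (p.vertex 0) (p.vertex k.castSucc) (p.vertex k.succ)).fiber (A k) (obj k.castSucc) 1
  dist (k : Fin p.length) : Triangle.mk (ι k) (π k) (δ k) ∈ distTriang C

/-- An isomorphism between two Harder–Narasimhan sequences of `E` along the same path: equal
phases, and isomorphisms of all the objects that commute with all the maps and that induce the
identity of `E`. -/
@[ext]
structure HNSequence.Iso {Φ : Collection 𝕜 C V} {P : PreSlicing Φ} {i j : V} {p : ObjPath i j}
    {E : C} {hE : Φ.sub i j E} (S T : HNSequence P p E hE) where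
  phase_eq : S.phase = T.phase
  obj (k : Fin (p.length + 1)) : S.obj k ≅ T.obj k
  fac (k : Fin p.length) : S.A k ≅ T.A k
  obj_last : (obj (Fin.last p.length)).hom ≫ T.objLast.hom = S.objLast.hom
  comm_ι (k : Fin p.length) : S.ι k ≫ (obj k.succ).hom = (obj k.castSucc).hom ≫ T.ι k
  comm_π (k : Fin p.length) : S.π k ≫ (fac k).hom = (obj k.succ).hom ≫ T.π k
  comm_δ (k : Fin p.length) :
    S.δ k ≫ ((obj k.castSucc).hom)⟦(1 : ℤ)⟧' = (fac k).hom ≫ T.δ k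

/-- The support property of a central charge relative to a pre-slicing: for a norm on
`Γ_V ⊗ ℝ` there is a constant `K > 0` with `‖γ‖ ≤ K |Z(γ)|` for the class `γ = ε(E)` of every
nonzero semistable object `E`. -/
def SupportProperty {Φ : Collection 𝕜 C V} (Z : CentralCharge V) (P : PreSlicing Φ) : Prop :=
  ∃ N : Seminorm ℝ (ℝ ⊗[ℤ] Gamma V), (∀ x, N x = 0 → x = 0) ∧
    ∃ K : ℝ, 0 < K ∧ ∀ (i j : V) (θ : ℝ) (E : C) (hE : P.ss i j θ E), ¬ IsZero E →
      N ((1 : ℝ) ⊗ₜ[ℤ] Gamma.cls (Φ.ε E (P.ss_le i j θ E hE))) ≤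
        K * ‖Z.val (Φ.ε E (P.ss_le i j θ E hE))‖

/-- A `V`-stability condition `(Z, P)` on a `V`-collection. -/
structure StabilityCondition (Φ : Collection 𝕜 C V) where
  Z : CentralCharge V
  P : PreSlicing Φ
  support : SupportProperty Z P
  /-- The argument of `Z(E)` is `πθ` modulo `2π` for nonzero `E` in `P_ij(θ)`. -/
  phase_compat {i j : V} {θ : ℝ} {E : C} (hE : P.ss i j θ E) (h0 : ¬ IsZero E) :
    ∃ m : ℝ, 0 < m ∧
      Z.val (Φ.ε E (P.ss_le i j θ E hE)) = m * Complex.exp (Real.pi * θ * Complex.I)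
  exists_hn {i j : V} {E : C} (hE : Φ.sub i j E) (h0 : ¬ IsZero E) :
    ∃ p : ObjPath i j, Nonempty (HNSequence P p E hE)

end Stability

end VStab

end

/-! Uniqueness comes from the triangles, the vanishing of `Hom` from larger to smaller phase, and
the fact that `[1]` raises the phase by one. Paths can therefore be forgotten, and the sequences
compared as towers, possibly of different lengths. The last phase is the smallest. If it were larger
in one tower than in the other, all maps from `E` to the last factor of the other tower would
vanish, although the projection onto that factor is non-zero (`π_ne_zero`); so the last phases
agree. Now `Hom(E_{n-1}, B_m) = 0` and `Hom(E_{n-1}[1], A_n) = 0`, and symmetrically, so an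
isomorphism of the tops extends to the last triangles (`exists_iso_lastTriangle`). Descending
induction yields equal lengths and isomorphic towers. The same vanishing from shifted objects makes
each component of an isomorphism determined by the one above it (`Iso.obj_eq`, `Iso.fac_eq`). -/

namespace VStab

section Preliminaries

variable {C : Type u} [Category.{v} C] {n : ℕ}

/-- Extension of a family of isomorphisms by an isomorphism between the last objects. -/
def isoSnoc {X Y : Fin (n + 1) → C} (e : X (Fin.last n) ≅ Y (Fin.last n))
    (f : ∀ k : Fin n, X k.castSucc ≅ Y k.castSucc) (k : Fin (n + 1)) : X k ≅ Y k :=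
  Fin.lastCases (motive := fun k => X k ≅ Y k) e f k

lemma isoSnoc_last {X Y : Fin (n + 1) → C} (e : X (Fin.last n) ≅ Y (Fin.last n))
    (f : ∀ k : Fin n, X k.castSucc ≅ Y k.castSucc) : isoSnoc e f (Fin.last n) = e :=
  Fin.lastCases_last

lemma isoSnoc_castSucc {X Y : Fin (n + 1) → C} (e : X (Fin.last n) ≅ Y (Fin.last n))
    (f : ∀ k : Fin n, X k.castSucc ≅ Y k.castSucc) (k : Fin n) :
    isoSnoc e f k.castSucc = f k :=
  Fin.lastCases_castSucc k

variable [Preadditive C]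

/-- All morphisms from `X` to `Y` vanish. -/
def HomVanishes (X Y : C) : Prop := ∀ f : X ⟶ Y, f = 0

lemma HomVanishes.of_iso {X X' Y Y' : C} (e : X ≅ X') (e' : Y ≅ Y') (h : HomVanishes X Y) :
    HomVanishes X' Y' := by
  intro f
  have := h (e.hom ≫ f ≫ e'.inv)
  rw [← cancel_epi e.hom, ← cancel_mono e'.inv, Category.assoc, this, comp_zero, zero_comp]

end Preliminaries

/-! ### Vanishing of morphisms and exactness in distinguished triangles. -/

section Towers

variable {𝕜 : Type w} [Field 𝕜]
  {C : Type u} [Category.{v} C] [HasZeroObject C] [HasShift C ℤ] [Preadditive C]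
  [∀ n : ℤ, (shiftFunctor C n).Additive] [Pretriangulated C]

lemma HomVanishes.of_triangle {T : Triangle C} (hT : T ∈ distTriang C) {X : C}
    (h₁ : HomVanishes T.obj₁ X) (h₃ : HomVanishes T.obj₃ X) : HomVanishes T.obj₂ X := by
  intro f
  obtain ⟨g, rfl⟩ := T.yoneda_exact₂ hT f (h₁ _)
  rw [h₃ g, comp_zero]

omit [HasZeroObject C] [Pretriangulated C] in
lemma HomVanishes.shift_left {X Y : C} (h : HomVanishes X (Y⟦(-1 : ℤ)⟧)) :
    HomVanishes (X⟦(1 : ℤ)⟧) Y := by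
  intro f
  apply (shiftFunctor C (-1 : ℤ)).map_injective
  rw [Functor.map_zero]
  exact h.of_iso ((shiftEquiv C (1 : ℤ)).unitIso.app X) (Iso.refl _) _

/-- A morphism into the first object of a distinguished triangle is determined by its composition
with the first morphism if there are no morphisms from the shift to the third object. -/
lemma eq_of_comp_mor₁_eq {T : Triangle C} (hT : T ∈ distTriang C) {X : C}
    (h : HomVanishes (X⟦(1 : ℤ)⟧) T.obj₃) {a b : X ⟶ T.obj₁}
    (hab : a ≫ T.mor₁ = b ≫ T.mor₁) : a = b := by
  rw [← sub_eq_zero] at hab ⊢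
  rw [← Preadditive.sub_comp] at hab
  apply (shiftFunctor C (1 : ℤ)).map_injective
  rw [Functor.map_zero]
  obtain ⟨g, hg⟩ := T.coyoneda_exact₁ hT ((a - b)⟦(1 : ℤ)⟧')
    (by rw [← Functor.map_comp, hab, Functor.map_zero])
  rw [hg, h g, zero_comp]

/-- The difference of `a` and `b` factors through `T.mor₃`, hence through the shift of `T.obj₁`. -/
lemma eq_of_mor₂_comp_eq {T : Triangle C} (hT : T ∈ distTriang C) {Y : C}
    (h : HomVanishes (T.obj₁⟦(1 : ℤ)⟧) Y) {a b : T.obj₃ ⟶ Y}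
    (hab : T.mor₂ ≫ a = T.mor₂ ≫ b) : a = b := by
  rw [← sub_eq_zero] at hab ⊢
  rw [← Preadditive.comp_sub] at hab
  obtain ⟨g, hg⟩ := T.yoneda_exact₃ hT (a - b) hab
  rw [hg, h g, comp_zero]

/-- An isomorphism between the middle objects of two distinguished triangles extends to an
isomorphism of triangles if the necessary morphisms vanish. -/
lemma exists_iso_triangle {T T' : Triangle C} (hT : T ∈ distTriang C) (hT' : T' ∈ distTriang C)
    (h : HomVanishes T.obj₁ T'.obj₃) (h' : HomVanishes T'.obj₁ T.obj₃)
    (hs : HomVanishes (T.obj₁⟦(1 : ℤ)⟧) T.obj₃) (hs' : HomVanishes (T'.obj₁⟦(1 : ℤ)⟧) T'.obj₃)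
    (e : T.obj₂ ≅ T'.obj₂) : ∃ φ : T ≅ T', φ.hom.hom₂ = e.hom := by
  obtain ⟨a, ha⟩ := T'.coyoneda_exact₂ hT' (T.mor₁ ≫ e.hom) (h _)
  obtain ⟨b, hb⟩ := T.coyoneda_exact₂ hT (T'.mor₁ ≫ e.inv) (h' _)
  -- Both sides agree after composition with `T.mor₁`, because `e` and its inverse cancel there.
  have hab : a ≫ b = 𝟙 _ := eq_of_comp_mor₁_eq hT hs (by
    rw [Category.assoc, ← hb, ← Category.assoc, ← ha]; simp)
  have hba : b ≫ a = 𝟙 _ := eq_of_comp_mor₁_eq hT' hs' (by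
    rw [Category.assoc, ← ha, ← Category.assoc, ← hb]; simp)
  exact ⟨isoTriangleOfIso₁₂ T T' hT hT' ⟨a, b, hab, hba⟩ e ha, by simp⟩

/-! ### Semistable objects and towers. -/

variable [Linear 𝕜 C] {V : Type*} [Groupoid V] {Φ : Collection 𝕜 C V}

/-- The semistable objects of phase `θ`, over all pairs of objects of `V`. -/
def PreSlicing.Semistable (P : PreSlicing Φ) (θ : ℝ) (X : C) : Prop := ∃ i j, P.ss i j θ X

lemma PreSlicing.Semistable.homVanishes {P : PreSlicing Φ} {θ₁ θ₂ : ℝ} {X Y : C}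
    (hX : P.Semistable θ₁ X) (hY : P.Semistable θ₂ Y) (h : θ₂ < θ₁) : HomVanishes X Y := by
  obtain ⟨_, _, hX⟩ := hX
  obtain ⟨_, _, hY⟩ := hY
  exact fun f => P.hom_eq_zero h hX hY f

lemma PreSlicing.Semistable.shift_neg_one {P : PreSlicing Φ} {θ : ℝ} {X : C}
    (hX : P.Semistable θ X) : P.Semistable (θ - 1) (X⟦(-1 : ℤ)⟧) := by
  obtain ⟨i, j, hX⟩ := hX
  refine ⟨j, i, (P.ss_shift i j (θ - 1) _).1 ?_⟩
  have := P.ss_iso i j θ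
  rw [sub_add_cancel]
  exact (P.ss i j θ).prop_of_iso ((shiftEquiv C (1 : ℤ)).counitIso.app X).symm hX

/-- A tower of distinguished triangles with semistable factors of strictly decreasing phases. -/
structure Tower (P : PreSlicing Φ) (n : ℕ) where
  phase : Fin n → ℝ
  phase_anti : StrictAnti phase
  A : Fin n → C
  A_mem (k : Fin n) : P.Semistable (phase k) (A k)
  A_ne (k : Fin n) : ¬ IsZero (A k)
  obj : Fin (n + 1) → C
  obj_zero : IsZero (obj 0)
  ι (k : Fin n) : obj k.castSucc ⟶ obj k.succ
  π (k : Fin n) : obj k.succ ⟶ A k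
  δ (k : Fin n) : A k ⟶ (obj k.castSucc)⟦(1 : ℤ)⟧
  dist (k : Fin n) : Triangle.mk (ι k) (π k) (δ k) ∈ distTriang C

/-- The tower underlying a Harder–Narasimhan sequence. -/
def HNSequence.toTower {P : PreSlicing Φ} {i j : V} {p : ObjPath i j} {E : C} {hE : Φ.sub i j E}
    (S : HNSequence P p E hE) : Tower P p.length where
  phase := S.phase
  phase_anti := S.phase_anti
  A := S.A
  A_mem k := ⟨_, _, S.A_mem k⟩
  A_ne := S.A_ne
  obj := S.obj
  obj_zero := S.obj_zero
  ι := S.ι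
  π := S.π
  δ := S.δ
  dist := S.dist

namespace Tower

variable {P : PreSlicing Φ} {n m : ℕ}

/-- The tower without its last triangle. -/
def init (S : Tower P (n + 1)) : Tower P n where
  phase k := S.phase k.castSucc
  phase_anti _ _ h := S.phase_anti (Fin.castSucc_lt_castSucc_iff.2 h)
  A k := S.A k.castSucc
  A_mem k := S.A_mem k.castSucc
  A_ne k := S.A_ne k.castSucc
  obj k := S.obj k.castSucc
  obj_zero := S.obj_zero
  ι k := S.ι k.castSucc
  π k := S.π k.castSucc
  δ k := S.δ k.castSucc
  dist k := S.dist k.castSucc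

/-- The last object of a tower. -/
abbrev top (S : Tower P n) : C := S.obj (Fin.last n)

/-- The last triangle of a tower. -/
abbrev lastTriangle (S : Tower P (n + 1)) : Triangle C :=
  Triangle.mk (S.ι (Fin.last n)) (S.π (Fin.last n)) (S.δ (Fin.last n))

/-- `S.obj l` is an iterated extension of the factors with index strictly below `l`. -/
lemma homVanishes_obj (S : Tower P n) {X : C} (l : Fin (n + 1))
    (h : ∀ k : Fin n, k.castSucc < l → HomVanishes (S.A k) X) : HomVanishes (S.obj l) X := by
  induction l using Fin.induction with
  | zero => exact fun f => S.obj_zero.eq_of_src _ _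
  | succ l ih =>
    exact HomVanishes.of_triangle (S.dist l) (ih fun k hk => h k (hk.trans l.castSucc_lt_succ))
      (h l l.castSucc_lt_succ)

lemma homVanishes_of_phase_lt (S : Tower P n) (l : Fin (n + 1)) {φ : ℝ} {X : C}
    (hX : P.Semistable φ X) (h : ∀ k : Fin n, k.castSucc < l → φ < S.phase k) :
    HomVanishes (S.obj l) X :=
  S.homVanishes_obj l fun k hk => (S.A_mem k).homVanishes hX (h k hk)

/-- The shift gains one unit of phase, so a weak inequality suffices. -/
lemma homVanishes_shift_of_phase_le (S : Tower P n) (l : Fin (n + 1)) {φ : ℝ} {X : C}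
    (hX : P.Semistable φ X) (h : ∀ k : Fin n, k.castSucc < l → φ ≤ S.phase k) :
    HomVanishes ((S.obj l)⟦(1 : ℤ)⟧) X :=
  (S.homVanishes_of_phase_lt l hX.shift_neg_one fun k hk => by linarith [h k hk]).shift_left

lemma phase_lt_of_castSucc_lt (S : Tower P n) {k l : Fin n} (h : k.castSucc < l.castSucc) :
    S.phase l < S.phase k :=
  S.phase_anti (Fin.castSucc_lt_castSucc_iff.1 h)

lemma phase_last_le (S : Tower P (n + 1)) (k : Fin (n + 1)) :
    S.phase (Fin.last n) ≤ S.phase k :=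
  S.phase_anti.antitone (Fin.le_last k)

/-- Precomposition with `S.π k` is injective on endomorphisms of `S.A k`; if `S.π k` vanished, the
identity would equal zero. -/
lemma π_ne_zero (S : Tower P n) (k : Fin n) : S.π k ≠ 0 := by
  intro h
  refine S.A_ne k ((IsZero.iff_id_eq_zero _).2 ?_)
  refine eq_of_mor₂_comp_eq (S.dist k)
    (S.homVanishes_shift_of_phase_le _ (S.A_mem k) fun l hl => (S.phase_lt_of_castSucc_lt hl).le) ?_
  exact (congrArg (fun f => f ≫ 𝟙 (S.A k)) h).trans (zero_comp.trans comp_zero.symm)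

lemma not_isZero_top (S : Tower P (n + 1)) : ¬ IsZero S.top :=
  fun h => S.π_ne_zero (Fin.last n) (h.eq_of_src _ _)

lemma phase_last_le_of_iso (S : Tower P (n + 1)) (T : Tower P (m + 1)) (e : S.top ≅ T.top) :
    S.phase (Fin.last n) ≤ T.phase (Fin.last m) := by
  by_contra! h
  refine T.π_ne_zero (Fin.last m) ?_
  exact (S.homVanishes_of_phase_lt _ (T.A_mem (Fin.last m))
    fun k _ => h.trans_le (S.phase_last_le k)).of_iso e (Iso.refl _) _

lemma phase_last_eq_of_iso (S : Tower P (n + 1)) (T : Tower P (m + 1)) (e : S.top ≅ T.top) :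
    S.phase (Fin.last n) = T.phase (Fin.last m) :=
  (S.phase_last_le_of_iso T e).antisymm (T.phase_last_le_of_iso S e.symm)

lemma exists_iso_lastTriangle (S : Tower P (n + 1)) (T : Tower P (m + 1)) (e : S.top ≅ T.top) :
    ∃ φ : S.lastTriangle ≅ T.lastTriangle, φ.hom.hom₂ = e.hom := by
  have he := S.phase_last_eq_of_iso T e
  refine exists_iso_triangle (S.dist (Fin.last n)) (T.dist (Fin.last m)) ?_ ?_ ?_ ?_ e
  · exact S.homVanishes_of_phase_lt _ (T.A_mem _) fun k hk =>
      he ▸ S.phase_lt_of_castSucc_lt hk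
  · exact T.homVanishes_of_phase_lt _ (S.A_mem _) fun k hk =>
      he.symm ▸ T.phase_lt_of_castSucc_lt hk
  · exact S.homVanishes_shift_of_phase_le _ (S.A_mem _) fun k _ => S.phase_last_le k
  · exact T.homVanishes_shift_of_phase_le _ (T.A_mem _) fun k _ => T.phase_last_le k

/-- Last triangles are peeled off in pairs; the two towers run out together, since the top is zero
only in a tower of length zero. -/
lemma length_eq_of_iso (S : Tower P n) (T : Tower P m) (e : S.top ≅ T.top) : n = m := by
  induction n generalizing m with
  | zero =>
    cases m with
    | zero => rfl
    | succ m => exact (T.not_isZero_top (S.obj_zero.of_iso e.symm)).elim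
  | succ n ih =>
    cases m with
    | zero => exact (S.not_isZero_top (T.obj_zero.of_iso e)).elim
    | succ m =>
      obtain ⟨φ, -⟩ := S.exists_iso_lastTriangle T e
      rw [ih S.init T.init (Triangle.π₁.mapIso φ)]

/-! ### Isomorphisms of towers: existence and uniqueness. -/

/-- An isomorphism of towers. -/
structure Iso (S T : Tower P n) where
  phase_eq (k : Fin n) : S.phase k = T.phase k
  obj (k : Fin (n + 1)) : S.obj k ≅ T.obj k
  fac (k : Fin n) : S.A k ≅ T.A k
  comm_ι (k : Fin n) : S.ι k ≫ (obj k.succ).hom = (obj k.castSucc).hom ≫ T.ι k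
  comm_π (k : Fin n) : S.π k ≫ (fac k).hom = (obj k.succ).hom ≫ T.π k
  comm_δ (k : Fin n) :
    S.δ k ≫ ((obj k.castSucc).hom)⟦(1 : ℤ)⟧' = (fac k).hom ≫ T.δ k

/-- Extension of an isomorphism of towers by an isomorphism of the last triangles. -/
def Iso.snoc {S T : Tower P (n + 1)} (f : S.init.Iso T.init) (φ : S.lastTriangle ≅ T.lastTriangle)
    (hφ : φ.hom.hom₁ = (f.obj (Fin.last n)).hom)
    (hp : S.phase (Fin.last n) = T.phase (Fin.last n)) : S.Iso T where
  phase_eq := Fin.lastCases hp f.phase_eq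
  obj := isoSnoc (X := S.obj) (Y := T.obj) (Triangle.π₂.mapIso φ) f.obj
  fac := isoSnoc (X := S.A) (Y := T.A) (Triangle.π₃.mapIso φ) f.fac
  comm_ι k := by
    have h := isoSnoc_castSucc (X := S.obj) (Y := T.obj) (Triangle.π₂.mapIso φ) f.obj
    induction k using Fin.lastCases with
    | last =>
      have h' := isoSnoc_last (X := S.obj) (Y := T.obj) (Triangle.π₂.mapIso φ) f.obj
      refine (congrArg (fun e => S.ι (Fin.last n) ≫ e.hom) h').trans (φ.hom.comm₁.trans ?_)
      -- Here `φ` and `f` meet: `hφ` identifies their components on the first object of the last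
      -- triangle.
      exact (congrArg (fun a => a ≫ T.ι (Fin.last n)) (hφ.trans
        (congrArg CategoryTheory.Iso.hom (h (Fin.last n)).symm)))
    | cast k =>
      refine (congrArg (fun e => S.ι k.castSucc ≫ e.hom) (h k.succ)).trans ((f.comm_ι k).trans ?_)
      exact congrArg (fun e => e.hom ≫ T.ι k.castSucc) (h k.castSucc).symm
  comm_π k := by
    induction k using Fin.lastCases with
    | last =>
      have h := isoSnoc_last (X := S.obj) (Y := T.obj) (Triangle.π₂.mapIso φ) f.obj
      have h' := isoSnoc_last (X := S.A) (Y := T.A) (Triangle.π₃.mapIso φ) f.fac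
      refine (congrArg (fun e => S.π (Fin.last n) ≫ e.hom) h').trans (φ.hom.comm₂.trans ?_)
      exact congrArg (fun e => e.hom ≫ T.π (Fin.last n)) h.symm
    | cast k =>
      have h := isoSnoc_castSucc (X := S.obj) (Y := T.obj) (Triangle.π₂.mapIso φ) f.obj
      have h' := isoSnoc_castSucc (X := S.A) (Y := T.A) (Triangle.π₃.mapIso φ) f.fac
      refine (congrArg (fun e => S.π k.castSucc ≫ e.hom) (h' k)).trans ((f.comm_π k).trans ?_)
      exact congrArg (fun e => e.hom ≫ T.π k.castSucc) (h k.succ).symm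
  comm_δ k := by
    have h := isoSnoc_castSucc (X := S.obj) (Y := T.obj) (Triangle.π₂.mapIso φ) f.obj
    induction k using Fin.lastCases with
    | last =>
      have h' := isoSnoc_last (X := S.A) (Y := T.A) (Triangle.π₃.mapIso φ) f.fac
      refine (congrArg (fun a => S.δ (Fin.last n) ≫ a⟦(1 : ℤ)⟧')
        ((congrArg CategoryTheory.Iso.hom (h (Fin.last n))).trans hφ.symm)).trans (φ.hom.comm₃.trans ?_)
      exact congrArg (fun e => e.hom ≫ T.δ (Fin.last n)) h'.symm
    | cast k =>
      have h' := isoSnoc_castSucc (X := S.A) (Y := T.A) (Triangle.π₃.mapIso φ) f.fac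
      refine (congrArg (fun e => S.δ k.castSucc ≫ (CategoryTheory.Iso.hom e)⟦(1 : ℤ)⟧')
        (h k.castSucc)).trans
        ((f.comm_δ k).trans ?_)
      exact congrArg (fun e => e.hom ≫ T.δ k.castSucc) (h' k).symm

/-- Prescribing the component at the top is what allows the induction to glue: the isomorphism of
the truncated towers must restrict to the first component of `φ`. -/
lemma exists_iso (S T : Tower P n) (e : S.top ≅ T.top) :
    ∃ f : S.Iso T, (f.obj (Fin.last n)).hom = e.hom := by
  induction n with
  | zero =>
    exact ⟨⟨fun k => k.elim0, Fin.lastCases e fun k => k.elim0, fun k => k.elim0,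
      fun k => k.elim0, fun k => k.elim0, fun k => k.elim0⟩, rfl⟩
  | succ n ih =>
    obtain ⟨φ, hφ⟩ := S.exists_iso_lastTriangle T e
    obtain ⟨f, hf⟩ := ih S.init T.init (Triangle.π₁.mapIso φ)
    refine ⟨f.snoc φ hf.symm (S.phase_last_eq_of_iso T e), ?_⟩
    exact (congrArg CategoryTheory.Iso.hom (isoSnoc_last (X := S.obj) (Y := T.obj) _ _)).trans hφ

/-- Descending induction: by `comm_ι`, the components at `k.castSucc` agree after composition with
`T.ι k`, which is injective on such maps. -/
lemma Iso.obj_eq {S T : Tower P n} (f g : S.Iso T)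
    (h : f.obj (Fin.last n) = g.obj (Fin.last n)) (k : Fin (n + 1)) : f.obj k = g.obj k := by
  induction k using Fin.reverseInduction with
  | last => exact h
  | cast k ih =>
    ext
    refine eq_of_comp_mor₁_eq (T.dist k) (S.homVanishes_shift_of_phase_le _ (T.A_mem k)
      fun l hl => f.phase_eq k ▸ (S.phase_lt_of_castSucc_lt hl).le) ?_
    exact (f.comm_ι k).symm.trans (by rw [ih, g.comm_ι k]; rfl)

lemma Iso.fac_eq {S T : Tower P n} (f g : S.Iso T)
    (h : f.obj (Fin.last n) = g.obj (Fin.last n)) (k : Fin n) : f.fac k = g.fac k := by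
  ext
  refine eq_of_mor₂_comp_eq (S.dist k) (S.homVanishes_shift_of_phase_le _ (T.A_mem k)
      fun l hl => f.phase_eq k ▸ (S.phase_lt_of_castSucc_lt hl).le) ?_
  exact (f.comm_π k).trans (by rw [f.obj_eq g h, ← g.comm_π k]; rfl)

lemma exists_factors_iso (S : Tower P n) (T : Tower P m) (e : S.top ≅ T.top) :
    ∃ h : n = m, ∀ k : Fin n,
      S.phase k = T.phase (Fin.cast h k) ∧ Nonempty (S.A k ≅ T.A (Fin.cast h k)) := by
  obtain rfl := S.length_eq_of_iso T e
  obtain ⟨f, -⟩ := S.exists_iso T e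
  exact ⟨rfl, fun k => ⟨f.phase_eq k, ⟨f.fac k⟩⟩⟩

end Tower

/-! ### Return to Harder–Narasimhan sequences. -/

namespace HNSequence

variable {P : PreSlicing Φ} {i j : V} {p : ObjPath i j} {E : C} {hE : Φ.sub i j E}

/-- The isomorphism of towers underlying an isomorphism of Harder–Narasimhan sequences. -/
def Iso.toTowerIso {S T : HNSequence P p E hE} (f : S.Iso T) : S.toTower.Iso T.toTower :=
  ⟨congrFun f.phase_eq, f.obj, f.fac, f.comm_ι, f.comm_π, f.comm_δ⟩

lemma Iso.eq {S T : HNSequence P p E hE} (f g : S.Iso T) : f = g := by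
  -- Compatibility with the identifications with `E` fixes the top component; everything below
  -- follows from it.
  have h : f.obj (Fin.last p.length) = g.obj (Fin.last p.length) := by
    ext
    rw [← cancel_mono T.objLast.hom, f.obj_last, g.obj_last]
  exact Iso.ext (funext (f.toTowerIso.obj_eq g.toTowerIso h))
    (funext (f.toTowerIso.fac_eq g.toTowerIso h))

lemma nonempty_iso (S T : HNSequence P p E hE) : Nonempty (S.Iso T) := by
  -- This is the only top component compatible with `obj_last`.
  obtain ⟨f, hf⟩ := S.toTower.exists_iso T.toTower (S.objLast ≪≫ T.objLast.symm)
  refine ⟨⟨funext f.phase_eq, f.obj, f.fac, ?_, f.comm_ι, f.comm_π, f.comm_δ⟩⟩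
  exact (congrArg (fun a => a ≫ T.objLast.hom) hf).trans
    ((Category.assoc _ _ _).trans
      ((congrArg (fun a => S.objLast.hom ≫ a) T.objLast.inv_hom_id).trans (Category.comp_id _)))

end HNSequence

end Towers

end VStab

theorem mainTheorem2 {𝕜 : Type*} [Field 𝕜]
    {C : Type*} [Category* C] [HasZeroObject C] [HasShift C ℤ] [Preadditive C]
    [∀ n : ℤ, (shiftFunctor C n).Additive] [Pretriangulated C] [IsTriangulated C]
    [Linear 𝕜 C] [∀ n : ℤ, (shiftFunctor C n).Linear 𝕜]
    {V : Type*} [Groupoid V]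
    (Φ : VStab.Collection 𝕜 C V) (σ : VStab.StabilityCondition Φ)
    {i j : V} (E : C) (hE : Φ.sub i j E) :
    (∀ (p : VStab.ObjPath i j) (S T : VStab.HNSequence σ.P p E hE),
      ∃ f : S.Iso T, ∀ g : S.Iso T, g = f) ∧
    (∀ (p q : VStab.ObjPath i j) (S : VStab.HNSequence σ.P p E hE)
      (T : VStab.HNSequence σ.P q E hE),
      ∃ h : p.length = q.length, ∀ k : Fin p.length,
        S.phase k = T.phase (Fin.cast h k) ∧ Nonempty (S.A k ≅ T.A (Fin.cast h k))) := by
  refine ⟨fun p S T => ?_, fun p q S T => ?_⟩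
  · obtain ⟨f⟩ := S.nonempty_iso T
    exact ⟨f, fun g => g.eq f⟩
  · exact S.toTower.exists_factors_iso T.toTower (S.objLast ≪≫ T.objLast.symm)
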